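/- Let $n,s\ge 1$, let $B_0,B_i^j\in\mathbb{R}^{n\times n}$ and $b_0,b_i^j\in\mathbb{R}^n$ for $1\le i\le s$, $1\le j\le 2^{i-1}$, and let $\gamma,\rho_1,\rho_2>0$, $\lambda_1\in(0,1)$, $\lambda_2>1$. Let $\|\cdot\|$ be the Euclidean norm of vectors and the spectral norm of matrices, let $\sigma_{\min}$ be the smallest singular value, and let $|\cdot|$ act componentwise on vectors. For $k\ge 1$ define recursively $$\phi_k[C^1,\dots,C^{2^{k-1}},c^1,\dots,c^{2^{k-1}}](x)=\Big|C^1x+c^1+\sum_{m=1}^{k-1}\phi_m[C^{2^{m-1}+1},\dots,C^{2^m},c^{2^{m-1}+1},\dots,c^{2^m}](x)\Big|,$$ and put $$\varphi_s(x)=B_0x+b_0+\sum_{i=1}^s\phi_i[B_i^1,\dots,B_i^{2^{i-1}},b_i^1,\dots,b_i^{2^{i-1}}](x),\qquad g(x)=\gamma B_0^\top\varphi_s(x),\qquad S=\sum_{i=1}^s\sum_{j=1}^{2^{i-1}}\|B_i^j\|.$$ Consider on $\mathbb{R}^n$ the dynamical system $$\frac{dx}{dt}=-\rho(x)\,g(x),\qquad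 \rho(x)=\begin{cases}\dfrac{\rho_1}{\|g(x)\|^{1-\lambda_1}}+\dfrac{\rho_2}{\|g(x)\|^{1-\lambda_2}}, & B_0^\top\varphi_s(x)\neq 0,\\[2mm] 0, & B_0^\top\varphi_s(x)=0.\end{cases}$$ Assume $\sigma_{\min}(B_0)>S$. Then the system has a unique equilibrium point $x_*$; for every $x_0\in\mathbb{R}^n$ it has a unique solution $x(t;x_0)$ on $[0,\infty)$ with $x(0;x_0)=x_0$; and $x_*$ is globally fixed-time stable, that is, it is Lyapunov stable, every solution converges to $x_*$, and the settling time $$T(x_0)=\inf\{\tau\ge 0:\ x(t;x_0)=x_*\ \text{for all } t\ge\tau\}$$ is finite for every $x_0$ and bounded uniformly in $x_0$. Concretely, for every $x_0\in\mathbb{R}^n$, $$T(x_0)\le \frac{1}{c_1(1-\kappa_1)}+\frac{1}{c_2(\kappa_2-1)},$$ where $\kappa_1=\frac{\lambda_1+1}{2}$, $\kappa_2=\frac{\lambda_2+1}{2}$ and $$c_1=\frac{2^{\frac{\lambda_1-1}{2}}\rho_1\gamma^{\lambda_1}}{\|B_0\|^{1-\lambda_1}}\,(\sigma_{\min}(B_0)-S)^{1+\lambda_1},\qquad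 c_2=2^{\frac{1-\lambda_2}{2}}\rho_2\gamma^{\lambda_2}\,(\sigma_{\min}(B_0)-S)^{2\lambda_2}.$$ -/

import Mathlib

open Filter Topology Set
open scoped ENNReal

noncomputable section

namespace NGAVE

/-! ### Autonomous differential equations and fixed-time stability -/

section Stability

variable {E : Type*} [NormedAddCommGroup E] [NormedSpace ℝ E]

/-- `x` is an equilibrium point of `dx/dt = f(x)`. -/
def IsEquilibrium (f : E → E) (x : E) : Prop := f x = 0

/-- `x` is a solution on `[0, ∞)` of `dx/dt = f(x)`, `x(0) = x₀`
(the values of `x` at negative times are irrelevant; the derivative at `0` is one-sided). -/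
def IsSolution (f : E → E) (x₀ : E) (x : ℝ → E) : Prop :=
  x 0 = x₀ ∧ ∀ t : ℝ, 0 ≤ t → HasDerivWithinAt x (f (x t)) (Ici 0) t

/-- Settling time of the initial point `x₀` with respect to `xs`: the infimum of the times `τ ≥ 0`
from which on every solution starting at `x₀` stays at `xs`; it is `∞` if there is no such time. -/
def settlingTime (f : E → E) (xs x₀ : E) : ℝ≥0∞ :=
  sInf {T : ℝ≥0∞ | ∃ τ : ℝ, 0 ≤ τ ∧ T = ENNReal.ofReal τ ∧
    ∀ x : ℝ → E, IsSolution f x₀ x → ∀ t : ℝ, τ ≤ t → x t = xs}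

/-- Global asymptotic stability of the equilibrium point `xs`: solutions exist for all times and all
initial points, `xs` is Lyapunov stable, and every solution converges to `xs`. -/
structure IsGloballyAsymptoticallyStable (f : E → E) (xs : E) : Prop where
  equilibrium : IsEquilibrium f xs
  exists_solution : ∀ x₀ : E, ∃ x : ℝ → E, IsSolution f x₀ x
  stable : ∀ ε : ℝ, 0 < ε → ∃ δ : ℝ, 0 < δ ∧ ∀ x₀ : E, ‖x₀ - xs‖ < δ →
    ∀ x : ℝ → E, IsSolution f x₀ x → ∀ t : ℝ, 0 ≤ t → ‖x t - xs‖ < ε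
  attractive : ∀ (x₀ : E) (x : ℝ → E), IsSolution f x₀ x → Tendsto x atTop (𝓝 xs)

/-- Global finite-time stability: global asymptotic stability, and every initial point has a finite
settling time. -/
structure IsGloballyFiniteTimeStable (f : E → E) (xs : E) : Prop where
  asymptoticallyStable : IsGloballyAsymptoticallyStable f xs
  finite_settlingTime : ∀ x₀ : E, settlingTime f xs x₀ < ∞

/-- Global fixed-time stability: global finite-time stability, and the settling time is bounded
uniformly in the initial point. -/
structure IsGloballyFixedTimeStable (f : E → E) (xs : E) : Prop where
  finiteTimeStable : IsGloballyFiniteTimeStable f xs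
  bounded_settlingTime : ∃ Tmax : ℝ, 0 < Tmax ∧
    ∀ x₀ : E, settlingTime f xs x₀ ≤ ENNReal.ofReal Tmax

end Stability

/-! ### The new generalized absolute value equations -/

section Equation

variable {n : ℕ}

/-- The linear map `x ↦ A x` on Euclidean space. -/
def mulVecE (A : Matrix (Fin n) (Fin n) ℝ) :
    EuclideanSpace ℝ (Fin n) →L[ℝ] EuclideanSpace ℝ (Fin n) :=
  Matrix.toEuclideanCLM (𝕜 := ℝ) A

/-- The spectral norm `‖A‖`, i.e. the operator norm for the Euclidean norm. -/
def specNorm (A : Matrix (Fin n) (Fin n) ℝ) : ℝ := ‖mulVecE A‖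

/-- The smallest singular value of `A`. Mathlib lists the `n` singular values of `A` in decreasing
order with indices `0, …, n - 1`. -/
def sigmaMin (A : Matrix (Fin n) (Fin n) ℝ) : ℝ :=
  (mulVecE A).toLinearMap.singularValues (n - 1)

/-- The componentwise absolute value of a vector. -/
def cwAbs (x : EuclideanSpace ℝ (Fin n)) : EuclideanSpace ℝ (Fin n) :=
  WithLp.toLp 2 fun i => |x i|

/-- `phi k C c x` is `φ_k[C¹, …, C^{2^{k-1}}, c¹, …, c^{2^{k-1}}](x)` for `k ≥ 1`, that is
`|C¹ x + c¹ + ∑_{m=1}^{k-1} φ_m[C^{2^{m-1}+1}, …, C^{2^m}, c^{2^{m-1}+1}, …, c^{2^m}](x)|`.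
The sequences `C`, `c` are indexed from `1`, and only their first `2^{k-1}` terms matter. The index
`m : Fin k` below stands for `m + 1` in the displayed sum. -/
def phi : (k : ℕ) → (C : ℕ → Matrix (Fin n) (Fin n) ℝ) → (c : ℕ → EuclideanSpace ℝ (Fin n)) →
    EuclideanSpace ℝ (Fin n) → EuclideanSpace ℝ (Fin n)
  | 0, _, _, _ => 0
  | k + 1, C, c, x =>
      cwAbs (mulVecE (C 1) x + c 1 +
        ∑ m : Fin k, phi (m.1 + 1) (fun j => C (2 ^ m.1 + j)) (fun j => c (2 ^ m.1 + j)) x)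
termination_by k => k
decreasing_by omega

/-- `φ_s(x) = B₀ x + b₀ + ∑_{i=1}^s φ_i[B_i¹, …, B_i^{2^{i-1}}, b_i¹, …, b_i^{2^{i-1}}](x)`, where
`B i j` is `B_i^j` and `b i j` is `b_i^j` (for `1 ≤ i ≤ s`, `1 ≤ j ≤ 2^{i-1}`). -/
def varphi (s : ℕ) (B₀ : Matrix (Fin n) (Fin n) ℝ) (B : ℕ → ℕ → Matrix (Fin n) (Fin n) ℝ)
    (b₀ : EuclideanSpace ℝ (Fin n)) (b : ℕ → ℕ → EuclideanSpace ℝ (Fin n))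
    (x : EuclideanSpace ℝ (Fin n)) : EuclideanSpace ℝ (Fin n) :=
  mulVecE B₀ x + b₀ + ∑ i ∈ Finset.Icc 1 s, phi i (B i) (b i) x

/-- `∑_{i=1}^s ∑_{j=1}^{2^{i-1}} ‖B_i^j‖`. -/
def normSum (s : ℕ) (B : ℕ → ℕ → Matrix (Fin n) (Fin n) ℝ) : ℝ :=
  ∑ i ∈ Finset.Icc 1 s, ∑ j ∈ Finset.Icc 1 (2 ^ (i - 1)), specNorm (B i j)

/-! ### The dynamical model -/

/-- `g(γ, x) = γ B₀ᵀ φ(x)`. -/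
def gField (B₀ : Matrix (Fin n) (Fin n) ℝ)
    (φ : EuclideanSpace ℝ (Fin n) → EuclideanSpace ℝ (Fin n)) (γ : ℝ)
    (x : EuclideanSpace ℝ (Fin n)) : EuclideanSpace ℝ (Fin n) :=
  γ • mulVecE B₀.transpose (φ x)

/-- `SOL(g) = {x : B₀ᵀ φ(x) = 0}`. -/
def solSet (B₀ : Matrix (Fin n) (Fin n) ℝ)
    (φ : EuclideanSpace ℝ (Fin n) → EuclideanSpace ℝ (Fin n)) :
    Set (EuclideanSpace ℝ (Fin n)) :=
  {x | mulVecE B₀.transpose (φ x) = 0}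

open Classical in
/-- The scalar factor `ρ(x)`, equal to `0` on `SOL(g)` and to
`ρ₁ / ‖g(γ, x)‖^{1 - l₁} + ρ₂ / ‖g(γ, x)‖^{1 - l₂}` elsewhere. -/
def rho (B₀ : Matrix (Fin n) (Fin n) ℝ)
    (φ : EuclideanSpace ℝ (Fin n) → EuclideanSpace ℝ (Fin n)) (γ ρ₁ ρ₂ l₁ l₂ : ℝ)
    (x : EuclideanSpace ℝ (Fin n)) : ℝ :=
  if x ∈ solSet B₀ φ then 0
  else ρ₁ / ‖gField B₀ φ γ x‖ ^ (1 - l₁) + ρ₂ / ‖gField B₀ φ γ x‖ ^ (1 - l₂)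

/-- The right-hand side `-ρ(x) g(γ, x)` of the dynamical model. -/
def modelField (B₀ : Matrix (Fin n) (Fin n) ℝ)
    (φ : EuclideanSpace ℝ (Fin n) → EuclideanSpace ℝ (Fin n)) (γ ρ₁ ρ₂ l₁ l₂ : ℝ)
    (x : EuclideanSpace ℝ (Fin n)) : EuclideanSpace ℝ (Fin n) :=
  -(rho B₀ φ γ ρ₁ ρ₂ l₁ l₂ x • gField B₀ φ γ x)

end Equation

end NGAVE

end

/-! Since componentwise absolute value is nonexpansive, `varphi` differs from the affine map `B₀ x +
b₀` by an `S`-Lipschitz map. As `σ_min(B₀) > S`, Banach's theorem gives a zero `p`, and `‖φ(x) -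
B₀(x - p)‖ ≤ S‖x - p‖ ≤ ‖B₀(x - p)‖`. Squaring yields `⟪x - p, g(x)⟫ ≥ γ‖φ(x)‖²/2`, while `‖φ(x)‖ ≥
(σ_min(B₀) - S)‖x - p‖`; so `g` points away from `p`, its only zero
(`sq_norm_varphi_le_inner_gField`, `sub_mul_norm_le_norm_varphi`).

For `V = ‖x - p‖²/2` these bounds give `V' ≤ -c₁ V^κ₁ - c₂ V^κ₂` along solutions. The superlinear
term brings `V` from any height below `1` within a fixed time, and the sublinear term then brings it
to `0` within another (`lt_of_fixedTime_differential_inequality`).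

Well-posedness is the delicate point, because the field `-h(‖g‖) g` need not be Lipschitz at `p`.
Freezing `h` below level `ε` gives locally Lipschitz fields that differ from the original only where
`‖x - p‖ < ε/m`. Since distances to `p` never increase, solutions for different levels stay
`2ε/m`-close (`norm_sub_le_of_isSolution_regField`), which gives both existence in the limit and
uniqueness. -/

namespace NGAVE

/-! ### Global solutions and uniqueness for locally Lipschitz fields -/

section GlobalSolutions

variable {E : Type*} [NormedAddCommGroup E]

theorem IsSolution.hasDerivWithinAt_Icc [NormedSpace ℝ E] {f : E → E} {x₀ : E} {x : ℝ → E}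
    (hx : IsSolution f x₀ x) (T : ℝ) :
    ∀ t ∈ Icc 0 T, HasDerivWithinAt x (f (x t)) (Icc 0 T) t :=
  fun t ht => (hx.2 t ht.1).mono Icc_subset_Ici_self

theorem IsSolution.continuousOn [NormedSpace ℝ E] {f : E → E} {x₀ : E} {x : ℝ → E}
    (hx : IsSolution f x₀ x) : ContinuousOn x (Ici 0) :=
  fun t ht => (hx.2 t ht).continuousWithinAt

/-- Curves whose velocity never points away from `p` approach `p` monotonically. -/
theorem antitoneOn_norm_sub_of_inner_nonpos [InnerProductSpace ℝ E] {x v : ℝ → E} {p : E} {T : ℝ}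
    (hx : ∀ t ∈ Icc 0 T, HasDerivWithinAt x (v t) (Icc 0 T) t)
    (hv : ∀ t ∈ Icc 0 T, inner ℝ (x t - p) (v t) ≤ 0) :
    AntitoneOn (fun t => ‖x t - p‖) (Icc 0 T) := by
  have hd : ∀ t ∈ Icc 0 T, HasDerivWithinAt (fun t => ‖x t - p‖ ^ 2)
      (2 * inner ℝ (x t - p) (v t)) (Icc 0 T) t :=
    fun t ht => ((hx t ht).sub_const p).norm_sq
  have ha : AntitoneOn (fun t => ‖x t - p‖ ^ 2) (Icc 0 T) := by
    refine antitoneOn_of_hasDerivWithinAt_nonpos (convex_Icc 0 T)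
      (fun t ht => (hd t ht).continuousWithinAt)
      (fun t ht => (hd t (interior_subset ht)).mono interior_subset) fun t ht => ?_
    linarith [hv t (interior_subset ht)]
  intro s hs t ht hst
  exact le_of_sq_le_sq (ha hs ht hst) (norm_nonneg _)

variable [NormedSpace ℝ E]

/-- Uniqueness for locally Lipschitz autonomous equations on a compact interval. -/
theorem eqOn_Icc_of_locallyLipschitz {G : E → E} (hG : LocallyLipschitz G) {x y : ℝ → E} {T : ℝ}
    (hx : ∀ t ∈ Icc 0 T, HasDerivWithinAt x (G (x t)) (Icc 0 T) t)
    (hy : ∀ t ∈ Icc 0 T, HasDerivWithinAt y (G (y t)) (Icc 0 T) t) (h0 : x 0 = y 0) :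
    EqOn x y (Icc 0 T) := by
  have hxc : ContinuousOn x (Icc 0 T) := fun t ht => (hx t ht).continuousWithinAt
  have hyc : ContinuousOn y (Icc 0 T) := fun t ht => (hy t ht).continuousWithinAt
  have hc : IsCompact (x '' Icc 0 T ∪ y '' Icc 0 T) :=
    (isCompact_Icc.image_of_continuousOn hxc).union (isCompact_Icc.image_of_continuousOn hyc)
  obtain ⟨K, hK⟩ := (hG.locallyLipschitzOn (s := x '' Icc 0 T ∪ y '' Icc 0 T)
    ).exists_lipschitzOnWith_of_compact hc
  have key : ∀ {z : ℝ → E}, (∀ t ∈ Icc 0 T, HasDerivWithinAt z (G (z t)) (Icc 0 T) t) →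
      ∀ t ∈ Ico 0 T, HasDerivWithinAt z (G (z t)) (Ici t) t := by
    intro z hz t ht
    exact (hz t (Ico_subset_Icc_self ht)).mono_of_mem_nhdsWithin
      (mem_of_superset (Icc_mem_nhdsGE ht.2) (Icc_subset_Icc_left ht.1))
  exact ODE_solution_unique_of_mem_Icc_right (v := fun _ => G)
    (s := fun _ => x '' Icc 0 T ∪ y '' Icc 0 T) (fun _ _ => hK) hxc (key hx)
    (fun t ht => Or.inl (mem_image_of_mem x (Ico_subset_Icc_self ht))) hyc (key hy)
    (fun t ht => Or.inr (mem_image_of_mem y (Ico_subset_Icc_self ht))) h0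

variable [ProperSpace E]

/-- Bounded locally Lipschitz vector fields have global forward solutions. -/
theorem exists_isSolution_of_bounded {F : E → E} (hF : LocallyLipschitz F) {C : ℝ}
    (hC : ∀ x, ‖F x‖ ≤ C) (x₀ : E) : ∃ x : ℝ → E, IsSolution F x₀ x := by
  have hC0 : 0 ≤ C := (norm_nonneg _).trans (hC 0)
  lift C to NNReal using hC0
  have hloc : ∀ N : ℕ, ∃ x : ℝ → E, x 0 = x₀ ∧
      ∀ t ∈ Icc (0 : ℝ) N, HasDerivWithinAt x (F (x t)) (Icc (0 : ℝ) N) t := by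
    intro N
    obtain ⟨K, hK⟩ := (hF.locallyLipschitzOn (s := Metric.closedBall x₀ (C * N))
      ).exists_lipschitzOnWith_of_compact (isCompact_closedBall _ _)
    -- At speed at most `C` the ball of radius `C * N` is not left during `[0, N]`, so
    -- Picard–Lindelöf covers the whole interval at once.
    have hP : IsPicardLindelof (fun _ => F) (tmin := 0) (tmax := N)
        ⟨0, left_mem_Icc.2 (Nat.cast_nonneg N)⟩ x₀ (C * N) 0 C K :=
      { lipschitzOnWith := fun _ _ => hK
        continuousOn := fun _ _ => continuousOn_const
        norm_le := fun _ _ x _ => hC x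
        mul_max_le := by simp }
    exact hP.exists_eq_forall_mem_Icc_hasDerivWithinAt₀
  choose X hX0 hX using hloc
  have hagree : ∀ {M N : ℕ}, M ≤ N → EqOn (X M) (X N) (Icc (0 : ℝ) M) := by
    intro M N hMN
    have hsub : Icc (0 : ℝ) M ⊆ Icc (0 : ℝ) N := Icc_subset_Icc_right (by exact_mod_cast hMN)
    exact eqOn_Icc_of_locallyLipschitz hF (hX M)
      (fun t ht => (hX N t (hsub ht)).mono hsub) ((hX0 M).trans (hX0 N).symm)
  -- The glued curve uses at time `t` the solution on `[0, ⌈t⌉₊]`; by uniqueness it agrees with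
  -- every longer one.
  have hval : ∀ (N : ℕ), EqOn (fun t => X (⌈t⌉₊) t) (X N) (Icc (0 : ℝ) N) := by
    intro N t ht
    exact hagree (Nat.ceil_le.2 ht.2) ⟨ht.1, Nat.le_ceil t⟩
  refine ⟨fun t => X (⌈t⌉₊) t, by simp [hX0], fun t ht => ?_⟩
  obtain ⟨N, hN⟩ := exists_nat_gt t
  have htN : t ∈ Icc (0 : ℝ) N := ⟨ht, hN.le⟩
  have h1 := (hX N t htN).congr (hval N) (hval N htN)
  rw [← hval N htN] at h1
  refine h1.mono_of_mem_nhdsWithin ?_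
  rw [← Ici_inter_Iic]
  exact inter_mem_nhdsWithin _ (Iic_mem_nhds hN)

end GlobalSolutions

/-! ### Global solutions of dissipative fields by truncation -/

section Dissipative

variable {E : Type*} [NormedAddCommGroup E] [InnerProductSpace ℝ E]

theorem locallyLipschitz_fun_smul {X : Type*} [PseudoEMetricSpace X] {a : X → ℝ} {F : X → E}
    (ha : LocallyLipschitz a) (hF : LocallyLipschitz F) :
    LocallyLipschitz fun x => a x • F x := by
  have h : LocallyLipschitz fun q : ℝ × E => q.1 • q.2 :=
    (contDiff_fst.smul contDiff_snd : ContDiff ℝ 1 fun q : ℝ × E => q.1 • q.2).locallyLipschitz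
  exact h.comp (ha.prodMk hF)

/-- Locally Lipschitz vector fields which never point away from `p` have global forward
solutions. -/
theorem exists_isSolution_of_inner_nonpos [ProperSpace E] {G : E → E} (hG : LocallyLipschitz G) {p : E}
    (hp : ∀ x, inner ℝ (x - p) (G x) ≤ 0) (x₀ : E) : ∃ x : ℝ → E, IsSolution G x₀ x := by
  set R : ℝ := ‖x₀ - p‖
  -- The cutoff is `1` for `‖x - p‖ ≤ R` and `0` beyond `R + 1`. The truncated field is bounded and
  -- still never points away from `p`, so its solution stays where `χ = 1`.
  set χ : E → ℝ := fun x => max 0 (min 1 (R + 1 - ‖x - p‖)) with hχ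
  have hχL : LocallyLipschitz χ := by
    have h1 : LocallyLipschitz fun x : E => R + 1 - ‖x - p‖ := by
      have : LipschitzWith (0 + (1 * (1 + 0))) fun x : E => R + 1 - ‖x - p‖ :=
        (LipschitzWith.const (R + 1)).sub
          (lipschitzWith_one_norm.comp (LipschitzWith.id.sub (LipschitzWith.const p)))
      exact this.locallyLipschitz
    exact (h1.const_min 1).const_max 0
  have hFL := locallyLipschitz_fun_smul hχL hG
  obtain ⟨C, hC⟩ := (isCompact_closedBall p (R + 1)).exists_bound_of_continuousOn
    hFL.continuous.continuousOn
  have hb : ∀ x, ‖χ x • G x‖ ≤ max C 0 := by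
    intro x
    by_cases hx : x ∈ Metric.closedBall p (R + 1)
    · exact (hC x hx).trans (le_max_left _ _)
    · have : R + 1 < ‖x - p‖ := by simpa [dist_eq_norm] using hx
      have h0 : χ x = 0 := max_eq_left ((min_le_right _ _).trans (by linarith))
      simp [h0]
  obtain ⟨x, hx⟩ := exists_isSolution_of_bounded hFL hb x₀
  refine ⟨x, hx.1, fun t ht => ?_⟩
  have hanti := antitoneOn_norm_sub_of_inner_nonpos (p := p) (hx.hasDerivWithinAt_Icc t)
    (fun s _ => by
      rw [inner_smul_right]
      exact mul_nonpos_of_nonneg_of_nonpos (le_max_left _ _) (hp _))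
  have hle : ‖x t - p‖ ≤ R := by
    have := hanti (left_mem_Icc.2 ht) (right_mem_Icc.2 ht) ht
    simpa [hx.1] using this
  have h1 : χ (x t) = 1 := by
    rw [hχ]
    simp only
    rw [min_eq_left (by linarith), max_eq_right zero_le_one]
  have := hx.2 t ht
  simp only [h1, one_smul] at this
  exact this

end Dissipative

/-! ### Fields with a singular scalar factor, by regularisation -/

section Singular

variable {E : Type*} [NormedAddCommGroup E] [InnerProductSpace ℝ E]

/-- The vector field `-h(‖g‖) g`, with the factor `h` frozen where `‖g‖ ≤ ε`. -/
noncomputable def regField (h : ℝ → ℝ) (g : E → E) (ε : ℝ) (x : E) : E :=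
  -(h (max ε ‖g x‖) • g x)

variable {h : ℝ → ℝ} {g : E → E} {p : E} {m : ℝ}

theorem regField_eq_of_le {δ ε : ℝ} {x : E} (hδ : δ ≤ ε) (hx : ε ≤ ‖g x‖) :
    regField h g δ x = regField h g ε x := by
  rw [regField, regField, max_eq_right (hδ.trans hx), max_eq_right hx]

/-- Cauchy–Schwarz. It confines the set `‖g x‖ < ε`, where freezing matters, to the ball of radius
`ε / m` about `p`. -/
theorem mul_norm_sub_le_of_inner (hm : ∀ x, m * ‖x - p‖ ^ 2 ≤ inner ℝ (x - p) (g x)) (x : E) :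
    m * ‖x - p‖ ≤ ‖g x‖ := by
  rcases eq_or_ne x p with rfl | hx
  · simp
  have h0 : 0 < ‖x - p‖ := norm_pos_iff.2 (sub_ne_zero.2 hx)
  have h1 := (hm x).trans (real_inner_le_norm _ _)
  refine le_of_mul_le_mul_left ?_ h0
  calc ‖x - p‖ * (m * ‖x - p‖) = m * ‖x - p‖ ^ 2 := by ring
    _ ≤ _ := h1

theorem inner_regField_nonpos (hm0 : 0 < m)
    (hm : ∀ x, m * ‖x - p‖ ^ 2 ≤ inner ℝ (x - p) (g x)) (hh : ∀ u, 0 < u → 0 ≤ h u) (ε : ℝ)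
    (x : E) : inner ℝ (x - p) (regField h g ε x) ≤ 0 := by
  rcases eq_or_ne (g x) 0 with h0 | h0
  · simp [regField, h0]
  rw [regField, inner_neg_right, inner_smul_right, neg_nonpos]
  exact mul_nonneg (hh _ (lt_max_of_lt_right (norm_pos_iff.2 h0)))
    ((by positivity : 0 ≤ m * ‖x - p‖ ^ 2).trans (hm x))

theorem locallyLipschitz_regField (hg : LocallyLipschitz g) {ε : ℝ}
    (hh : LocallyLipschitz fun u => h (max ε u)) : LocallyLipschitz (regField h g ε) := by
  have h1 : LocallyLipschitz fun x => h (max ε ‖g x‖) :=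
    hh.comp (lipschitzWith_one_norm.locallyLipschitz.comp hg)
  have h2 := locallyLipschitz_fun_smul h1 hg
  exact (LipschitzWith.id.neg (E := E)).locallyLipschitz.comp h2

/-- Joint continuity up to `ε = 0` is what allows the limit in the integral equation. At a zero of
`g` the norm of the field is at most `|h u * u|` with `u = max ε ‖g x‖`, which tends to `0`. -/
theorem continuousOn_regField (hg : Continuous g) (hh : ContinuousOn h (Ioi 0))
    (hlim : Tendsto (fun u => h u * u) (𝓝[>] 0) (𝓝 0)) :
    ContinuousOn (fun q : ℝ × E => regField h g q.1 q.2) (Ici 0 ×ˢ univ) := by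
  rintro ⟨ε, x⟩ ⟨hε : 0 ≤ ε, -⟩
  have hmax : Continuous fun q : ℝ × E => max q.1 ‖g q.2‖ := by fun_prop
  rcases (le_max_of_le_left hε : 0 ≤ max ε ‖g x‖).eq_or_lt with h0 | h0
  · have hgx : g x = 0 := norm_le_zero_iff.1 (h0 ▸ le_max_right _ _)
    have hval : regField h g ε x = 0 := by simp [regField, hgx]
    -- At `u = 0` the product vanishes whatever `h 0` is, so the limit extends to `u ≥ 0`.
    have hW : Tendsto (fun u => |h u * u|) (𝓝[≥] 0) (𝓝 0) := by
      have hc : ContinuousWithinAt (fun u => |h u * u|) (Ioi 0) 0 := by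
        simpa [ContinuousWithinAt] using hlim.abs
      simpa [ContinuousWithinAt] using continuousWithinAt_Ioi_iff_Ici.1 hc
    have hmt : Tendsto (fun q : ℝ × E => max q.1 ‖g q.2‖) (𝓝[Ici 0 ×ˢ univ] (ε, x)) (𝓝[≥] 0) := by
      refine tendsto_nhdsWithin_of_tendsto_nhds_of_eventually_within _ ?_ ?_
      · have := hmax.tendsto (ε, x)
        simp only [← h0] at this
        exact this.mono_left nhdsWithin_le_nhds
      · filter_upwards [self_mem_nhdsWithin] with q hq
        exact le_max_of_le_left (mem_Ici.1 hq.1)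
    rw [ContinuousWithinAt]
    simp only [hval]
    refine squeeze_zero_norm' ?_ (hW.comp hmt)
    filter_upwards [self_mem_nhdsWithin] with q hq
    have hq0 : 0 ≤ max q.1 ‖g q.2‖ := le_max_of_le_left hq.1
    simp only [regField, norm_neg, norm_smul, Function.comp_apply, abs_mul, Real.norm_eq_abs,
      abs_of_nonneg hq0]
    gcongr
    exact le_max_right _ _
  · have h1 : ContinuousAt (fun q : ℝ × E => h (max q.1 ‖g q.2‖)) (ε, x) :=
      ContinuousAt.comp (g := h) (hh.continuousAt (Ioi_mem_nhds h0)) hmax.continuousAt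
    exact ((h1.smul (hg.comp continuous_snd).continuousAt).neg).continuousWithinAt

/-- Solutions of two regularisations of the same singular equation stay close. -/
theorem norm_sub_le_of_isSolution_regField (hm0 : 0 < m)
    (hm : ∀ x, m * ‖x - p‖ ^ 2 ≤ inner ℝ (x - p) (g x)) (hh : ∀ u, 0 < u → 0 ≤ h u)
    {δ ε : ℝ} (hε : 0 ≤ ε) (hδ : δ ≤ ε) (hL : LocallyLipschitz (regField h g ε)) {x₀ : E} {x y : ℝ → E}
    (hx : IsSolution (regField h g ε) x₀ x) (hy : IsSolution (regField h g δ) x₀ y)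
    {t : ℝ} (ht : 0 ≤ t) : ‖x t - y t‖ ≤ 2 * (ε / m) := by
  have hxa := antitoneOn_norm_sub_of_inner_nonpos (hx.hasDerivWithinAt_Icc t)
    (fun s _ => inner_regField_nonpos hm0 hm hh ε (x s))
  have hya : ∀ {s : ℝ}, AntitoneOn (fun t => ‖y t - p‖) (Icc 0 s) := fun {s} =>
    antitoneOn_norm_sub_of_inner_nonpos (hy.hasDerivWithinAt_Icc s)
      (fun s _ => inner_regField_nonpos hm0 hm hh δ (y s))
  -- If `y` is outside the ball of radius `ε / m` at time `s`, it was outside at all earlier times.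
  -- There both fields agree along `y`, so `y` solves the locally Lipschitz `ε`-equation and equals
  -- `x`.
  have heq : ∀ s, 0 ≤ s → ε / m ≤ ‖y s - p‖ → x s = y s := by
    intro s hs hfar
    refine eqOn_Icc_of_locallyLipschitz hL (hx.hasDerivWithinAt_Icc s) (fun r hr => ?_)
      (hx.1.trans hy.1.symm) (right_mem_Icc.2 hs)
    have h1 : ε ≤ ‖g (y r)‖ := by
      have h2 := hfar.trans (hya hr (right_mem_Icc.2 hs) hr.2)
      rw [div_le_iff₀ hm0, mul_comm] at h2
      exact h2.trans (mul_norm_sub_le_of_inner hm _)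
    rw [← regField_eq_of_le hδ h1]
    exact hy.hasDerivWithinAt_Icc s r hr
  by_cases hyt : ε / m ≤ ‖y t - p‖
  · rw [heq t ht hyt, sub_self, norm_zero]
    positivity
  push Not at hyt
  -- Otherwise `y` starts outside the ball and crosses its sphere at some `s ≤ t`; there `x s = y
  -- s`, and `x` cannot move outwards afterwards.
  have hxt : ‖x t - p‖ ≤ ε / m := by
    by_contra! hlt
    have h0 : ε / m ≤ ‖y 0 - p‖ := by
      have := hxa (left_mem_Icc.2 ht) (right_mem_Icc.2 ht) ht
      simp only [hx.1, ← hy.1] at this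
      exact hlt.le.trans this
    have hc : ContinuousOn (fun s => ‖y s - p‖) (Icc 0 t) :=
      ((hy.continuousOn.mono Icc_subset_Ici_self).sub continuousOn_const).norm
    obtain ⟨s, hs, hse⟩ := intermediate_value_Icc' ht hc ⟨hyt.le, h0⟩
    have h1 := hxa hs (right_mem_Icc.2 ht) hs.2
    simp only at hse h1
    rw [heq s hs.1 hse.ge, hse] at h1
    exact absurd hlt h1.not_gt
  calc ‖x t - y t‖ = ‖(x t - p) - (y t - p)‖ := by congr 1; abel
    _ ≤ ‖x t - p‖ + ‖y t - p‖ := norm_sub_le _ _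
    _ ≤ 2 * (ε / m) := by linarith

variable [ProperSpace E]

/-- Existence and uniqueness of forward solutions of `x' = -h(‖g(x)‖) g(x)`, where `h` may be
singular at `0`, and `g` points away from its zero `p`. -/
theorem existsUnique_isSolution_regField_zero (hg : LocallyLipschitz g) (hm0 : 0 < m)
    (hm : ∀ x, m * ‖x - p‖ ^ 2 ≤ inner ℝ (x - p) (g x)) (hh : ∀ u, 0 < u → 0 ≤ h u)
    (hhc : ContinuousOn h (Ioi 0)) (hlip : ∀ ε, 0 < ε → LocallyLipschitz fun u => h (max ε u))
    (hlim : Tendsto (fun u => h u * u) (𝓝[>] 0) (𝓝 0)) (x₀ : E) :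
    ∃ x : ℝ → E, IsSolution (regField h g 0) x₀ x ∧
      ∀ y : ℝ → E, IsSolution (regField h g 0) x₀ y → EqOn y x (Ici 0) := by
  set e : ℕ → ℝ := fun n => 1 / ((n : ℝ) + 1) with he
  have he0 : ∀ n, 0 < e n := fun n => Nat.one_div_pos_of_nat
  have hea : Antitone e := fun a b hab => Nat.one_div_le_one_div hab
  have het : Tendsto e atTop (𝓝 0) := tendsto_one_div_add_atTop_nhds_zero_nat
  have heb : Tendsto (fun n => 2 * (e n / m)) atTop (𝓝 0) := by
    simpa using (het.div_const m).const_mul 2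
  have hL : ∀ n, LocallyLipschitz (regField h g (e n)) := fun n =>
    locallyLipschitz_regField hg (hlip _ (he0 n))
  choose X hX using fun n => exists_isSolution_of_inner_nonpos (hL n)
    (inner_regField_nonpos hm0 hm hh (e n)) x₀
  have hdist : ∀ n k, n ≤ k → ∀ t, 0 ≤ t → ‖X n t - X k t‖ ≤ 2 * (e n / m) := fun n k hnk t ht =>
    norm_sub_le_of_isSolution_regField hm0 hm hh (he0 n).le (hea hnk) (hL n) (hX n) (hX k) ht
  -- The limit is claimed only for `t ≥ 0`; at negative times the chosen value is irrelevant.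
  have hlimX : ∀ t, ∃ z, 0 ≤ t → Tendsto (fun n => X n t) atTop (𝓝 z) := by
    intro t
    by_cases ht : 0 ≤ t
    · have hc : CauchySeq fun n => X n t := by
        refine cauchySeq_of_le_tendsto_0' (fun n => 2 * (e n / m)) (fun n k hnk => ?_) heb
        rw [dist_eq_norm]
        exact hdist n k hnk t ht
      obtain ⟨z, hz⟩ := cauchySeq_tendsto_of_complete hc
      exact ⟨z, fun _ => hz⟩
    · exact ⟨0, fun h => absurd h ht⟩
  choose x hx using hlimX
  have hunif : ∀ n t, 0 ≤ t → ‖X n t - x t‖ ≤ 2 * (e n / m) := fun n t ht =>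
    le_of_tendsto ((tendsto_const_nhds.sub (hx t ht)).norm)
      (eventually_atTop.2 ⟨n, fun k hk => hdist n k hk t ht⟩)
  have hxu : TendstoUniformlyOn X x atTop (Ici 0) := by
    rw [Metric.tendstoUniformlyOn_iff]
    intro η hη
    filter_upwards [heb.eventually_lt_const hη] with n hn t ht
    rw [dist_comm, dist_eq_norm]
    exact (hunif n t ht).trans_lt hn
  have hxc : ContinuousOn x (Ici 0) :=
    hxu.continuousOn (Frequently.of_forall fun n => (hX n).continuousOn)
  have hreg := continuousOn_regField (E := E) hg.continuous hhc hlim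
  have hfc : Continuous (regField h g 0) := by
    rw [← continuousOn_univ]
    exact hreg.comp (f := fun z => ((0 : ℝ), z)) (by fun_prop) fun z _ => by simp
  have hball : ∀ n t, 0 ≤ t → X n t ∈ Metric.closedBall p ‖x₀ - p‖ := by
    intro n t ht
    have := antitoneOn_norm_sub_of_inner_nonpos ((hX n).hasDerivWithinAt_Icc t)
      (fun s _ => inner_regField_nonpos hm0 hm hh (e n) (X n s)) (left_mem_Icc.2 ht)
      (right_mem_Icc.2 ht) ht
    simpa [dist_eq_norm, (hX n).1] using this
  -- One bound serves all levels: every `e n` lies in `[0, 1]` and every `X n` stays in the ball of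
  -- radius `‖x₀ - p‖`. It is the dominating constant below.
  obtain ⟨C, hC⟩ := ((isCompact_Icc (a := (0 : ℝ)) (b := 1)).prod
    (isCompact_closedBall p ‖x₀ - p‖)).exists_bound_of_continuousOn
      (hreg.mono (prod_mono Icc_subset_Ici_self (subset_univ _)))
  have hint : ∀ t, 0 ≤ t → x t = x₀ + ∫ s in (0 : ℝ)..t, regField h g 0 (x s) := by
    intro t ht
    have hIoc : uIoc 0 t ⊆ Ici 0 := by
      rw [uIoc_of_le ht]
      exact fun s hs => hs.1.le
    have h1 : ∀ n, x₀ + ∫ s in (0 : ℝ)..t, regField h g (e n) (X n s) = X n t := by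
      intro n
      have := ODE.picard_eq_of_hasDerivAt (f := fun _ => regField h g (e n)) (α := X n) (t₀ := 0)
        (t := t) (u := univ) ((hL n).continuous.comp continuous_snd).continuousOn
        (by rw [uIcc_of_le ht]; exact (hX n).hasDerivWithinAt_Icc t) (mapsTo_univ _ _)
      rwa [(hX n).1] at this
    have h2 : Tendsto (fun n => ∫ s in (0 : ℝ)..t, regField h g (e n) (X n s)) atTop
        (𝓝 (∫ s in (0 : ℝ)..t, regField h g 0 (x s))) := by
      refine intervalIntegral.tendsto_integral_filter_of_dominated_convergence (fun _ => C)
        (Eventually.of_forall fun n => ?_) (Eventually.of_forall fun n => ?_)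
        intervalIntegrable_const ?_
      · exact (((hL n).continuous.comp_continuousOn (hX n).continuousOn).mono
          hIoc).aestronglyMeasurable measurableSet_uIoc
      · refine MeasureTheory.ae_of_all _ fun s hs =>
          hC (e n, X n s) ⟨⟨(he0 n).le, ?_⟩, hball n s (hIoc hs)⟩
        simpa [he] using hea (Nat.zero_le n)
      · refine MeasureTheory.ae_of_all _ fun s hs => ?_
        have h3 : Tendsto (fun n => (e n, X n s)) atTop (𝓝[Ici 0 ×ˢ univ] (0, x s)) :=
          tendsto_nhdsWithin_of_tendsto_nhds_of_eventually_within _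
            (het.prodMk_nhds (hx s (hIoc hs)))
            (Eventually.of_forall fun n => ⟨(he0 n).le, mem_univ _⟩)
        exact (hreg (0, x s) (by simp)).tendsto.comp h3
    refine tendsto_nhds_unique (hx t ht) ?_
    simpa only [h1] using h2.const_add x₀
  refine ⟨x, ⟨by simpa using hint 0 le_rfl, fun t ht => ?_⟩, fun y hy t ht => ?_⟩
  · have ht' : t ∈ Icc 0 (t + 1) := ⟨ht, by linarith⟩
    have h1 := ODE.hasDerivWithinAt_picard_Icc (f := fun _ => regField h g 0) (α := x) (t₀ := 0)
      (tmin := 0) (tmax := t + 1) (u := univ) (left_mem_Icc.2 (by linarith))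
      (hfc.comp continuous_snd).continuousOn (hxc.mono Icc_subset_Ici_self)
      (fun _ _ => mem_univ _) x₀ ht'
    have h2 := h1.congr (fun s hs => hint s hs.1) (hint t ht)
    refine h2.mono_of_mem_nhdsWithin ?_
    rw [← Ici_inter_Iic]
    exact inter_mem_nhdsWithin _ (Iic_mem_nhds (by linarith))
  -- Any solution is a regularised one at level `δ = 0`, hence within `2 * (e n / m)` of `X n` for
  -- every `n`.
  · refine tendsto_nhds_unique ?_ (hx t ht)
    refine tendsto_iff_norm_sub_tendsto_zero.2 (squeeze_zero (fun _ => norm_nonneg _)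
      (fun n => ?_) heb)
    exact norm_sub_le_of_isSolution_regField hm0 hm hh (he0 n).le (he0 n).le (hL n) (hX n) hy ht

end Singular

/-! ### Fixed-time extinction for a scalar differential inequality -/

section Settling

variable {V V' : ℝ → ℝ} {T c κ : ℝ}

/-- Separation of variables for `V' ≤ -c V^κ`: the factor in brackets is then nonpositive, and the
sign of `1 - κ` decides the direction of monotonicity. -/
theorem hasDerivWithinAt_rpow_add_linear
    (hV : ∀ t ∈ Icc 0 T, HasDerivWithinAt V (V' t) (Icc 0 T) t) (hpos : ∀ t ∈ Icc 0 T, 0 < V t) :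
    ∀ t ∈ Icc 0 T, HasDerivWithinAt (fun t => V t ^ (1 - κ) + (1 - κ) * c * t)
      ((1 - κ) * (V' t / V t ^ κ + c)) (Icc 0 T) t := by
  intro t ht
  have h1 := ((hV t ht).rpow_const (p := 1 - κ) (Or.inl (hpos t ht).ne')).add
    ((hasDerivWithinAt_id t (Icc 0 T)).const_mul ((1 - κ) * c))
  refine h1.congr_deriv ?_
  rw [show 1 - κ - 1 = -κ by ring, Real.rpow_neg (hpos t ht).le]
  ring

theorem deriv_div_rpow_add_nonpos (hpos : ∀ t ∈ Icc 0 T, 0 < V t)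
    (hle : ∀ t ∈ Icc 0 T, V' t ≤ -(c * V t ^ κ)) : ∀ t ∈ Icc 0 T, V' t / V t ^ κ + c ≤ 0 := by
  intro t ht
  have h0 : 0 < V t ^ κ := Real.rpow_pos_of_pos (hpos t ht) κ
  have := (div_le_iff₀ h0).2 ((hle t ht).trans_eq (neg_mul _ _).symm)
  linarith

theorem antitoneOn_rpow_add_linear (hκ : κ ≤ 1)
    (hV : ∀ t ∈ Icc 0 T, HasDerivWithinAt V (V' t) (Icc 0 T) t) (hpos : ∀ t ∈ Icc 0 T, 0 < V t)
    (hle : ∀ t ∈ Icc 0 T, V' t ≤ -(c * V t ^ κ)) :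
    AntitoneOn (fun t => V t ^ (1 - κ) + (1 - κ) * c * t) (Icc 0 T) := by
  have hd := hasDerivWithinAt_rpow_add_linear (c := c) (κ := κ) hV hpos
  exact antitoneOn_of_hasDerivWithinAt_nonpos (convex_Icc 0 T)
    (fun t ht => (hd t ht).continuousWithinAt)
    (fun t ht => (hd t (interior_subset ht)).mono interior_subset) fun t ht =>
      mul_nonpos_of_nonneg_of_nonpos (by linarith)
        (deriv_div_rpow_add_nonpos hpos hle t (interior_subset ht))

theorem monotoneOn_rpow_add_linear (hκ : 1 ≤ κ)
    (hV : ∀ t ∈ Icc 0 T, HasDerivWithinAt V (V' t) (Icc 0 T) t) (hpos : ∀ t ∈ Icc 0 T, 0 < V t)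
    (hle : ∀ t ∈ Icc 0 T, V' t ≤ -(c * V t ^ κ)) :
    MonotoneOn (fun t => V t ^ (1 - κ) + (1 - κ) * c * t) (Icc 0 T) := by
  have hd := hasDerivWithinAt_rpow_add_linear (c := c) (κ := κ) hV hpos
  exact monotoneOn_of_hasDerivWithinAt_nonneg (convex_Icc 0 T)
    (fun t ht => (hd t ht).continuousWithinAt)
    (fun t ht => (hd t (interior_subset ht)).mono interior_subset) fun t ht =>
      mul_nonneg_of_nonpos_of_nonpos (by linarith)
        (deriv_div_rpow_add_nonpos hpos hle t (interior_subset ht))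

/-- Polyakov's estimate: `V' ≤ -c₁ V^κ₁ - c₂ V^κ₂` with `κ₁ < 1 < κ₂` cannot keep `V` positive up
to the time `1 / (c₁ (1 - κ₁)) + 1 / (c₂ (κ₂ - 1))`. -/
theorem lt_of_fixedTime_differential_inequality {c₁ c₂ κ₁ κ₂ : ℝ} (hc₁ : 0 < c₁) (hc₂ : 0 < c₂)
    (hκ₁ : κ₁ < 1) (hκ₂ : 1 < κ₂)
    (hV : ∀ t ∈ Icc 0 T, HasDerivWithinAt V (V' t) (Icc 0 T) t) (hpos : ∀ t ∈ Icc 0 T, 0 < V t)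
    (hle : ∀ t ∈ Icc 0 T, V' t ≤ -(c₁ * V t ^ κ₁ + c₂ * V t ^ κ₂)) :
    T < 1 / (c₁ * (1 - κ₁)) + 1 / (c₂ * (κ₂ - 1)) := by
  by_contra! hT
  have hk₁ : 0 < 1 - κ₁ := by linarith
  have hk₂ : 0 < κ₂ - 1 := by linarith
  have hT₁ : 0 < 1 / (c₁ * (1 - κ₁)) := by positivity
  set T₂ := 1 / (c₂ * (κ₂ - 1)) with hT₂
  have hT₂0 : 0 < T₂ := by positivity
  have m0 : (0 : ℝ) ∈ Icc 0 T := ⟨le_rfl, by linarith⟩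
  have m2 : T₂ ∈ Icc 0 T := ⟨hT₂0.le, by linarith⟩
  have mT : T ∈ Icc 0 T := ⟨by linarith, le_rfl⟩
  -- On `[0, T₂]` only the superlinear term is kept: `V^(1 - κ₂)` gains at least `1`, forcing `V T₂
  -- < 1`. On `[T₂, T]` the sublinear term alone would then make `V^(1 - κ₁)` negative.
  have hm := monotoneOn_rpow_add_linear (c := c₂) hκ₂.le hV hpos (fun t ht => by
    have := mul_pos hc₁ (Real.rpow_pos_of_pos (hpos t ht) κ₁)
    linarith [hle t ht]) m0 m2 hT₂0.le
  have ha := antitoneOn_rpow_add_linear (c := c₁) hκ₁.le hV hpos (fun t ht => by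
    have := mul_pos hc₂ (Real.rpow_pos_of_pos (hpos t ht) κ₂)
    linarith [hle t ht]) m2 mT m2.2
  simp only at hm ha
  have h2 : (1 - κ₂) * c₂ * T₂ = -1 := by
    rw [hT₂]; field_simp; ring
  have h1 : 1 ≤ (1 - κ₁) * c₁ * (T - T₂) := by
    have : (1 - κ₁) * c₁ * (1 / (c₁ * (1 - κ₁))) = 1 := by field_simp
    refine this.symm.le.trans ?_
    exact mul_le_mul_of_nonneg_left (by linarith) (by positivity)
  have h3 : 1 < V T₂ ^ (1 - κ₂) := by
    have := Real.rpow_pos_of_pos (hpos 0 m0) (1 - κ₂)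
    linarith
  have h4 : V T₂ < 1 := by
    by_contra! h
    exact h3.not_ge (Real.rpow_le_one_of_one_le_of_nonpos h (by linarith))
  have h5 : V T₂ ^ (1 - κ₁) < 1 := Real.rpow_lt_one (hpos _ m2).le h4 hk₁
  have h6 := Real.rpow_pos_of_pos (hpos T mT) (1 - κ₁)
  linarith

end Settling

/-! ### Lyapunov criterion -/

section Stability

variable {E : Type*} [NormedAddCommGroup E] [InnerProductSpace ℝ E] {f : E → E} {p : E}

/-- Lyapunov criterion for global fixed-time stability with the Lyapunov function `‖x - p‖² / 2`,
including the bound for the settling time. -/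
theorem isGloballyFixedTimeStable_of_inner_le {c₁ c₂ κ₁ κ₂ : ℝ} (hc₁ : 0 < c₁) (hc₂ : 0 < c₂)
    (hκ₁ : κ₁ < 1) (hκ₂ : 1 < κ₂) (hp : IsEquilibrium f p)
    (hex : ∀ x₀, ∃ x : ℝ → E, IsSolution f x₀ x)
    (hf : ∀ x, x ≠ p → inner ℝ (x - p) (f x) ≤
      -(c₁ * (‖x - p‖ ^ 2 / 2) ^ κ₁ + c₂ * (‖x - p‖ ^ 2 / 2) ^ κ₂)) :
    IsGloballyFixedTimeStable f p ∧
      ∀ x₀, settlingTime f p x₀ ≤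
        ENNReal.ofReal (1 / (c₁ * (1 - κ₁)) + 1 / (c₂ * (κ₂ - 1))) := by
  have hk₁ : 0 < 1 - κ₁ := by linarith
  have hk₂ : 0 < κ₂ - 1 := by linarith
  set T := 1 / (c₁ * (1 - κ₁)) + 1 / (c₂ * (κ₂ - 1)) with hT
  have hT0 : 0 < T := by positivity
  have hdis : ∀ x, inner ℝ (x - p) (f x) ≤ 0 := by
    intro x
    rcases eq_or_ne x p with rfl | hx
    · simp
    · refine (hf x hx).trans (neg_nonpos.2 ?_)
      positivity
  have hanti : ∀ {x₀ : E} {x : ℝ → E}, IsSolution f x₀ x → ∀ {t}, AntitoneOn (fun t => ‖x t - p‖) (Icc 0 t) :=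
    fun {_ _} hx {t} => antitoneOn_norm_sub_of_inner_nonpos (hx.hasDerivWithinAt_Icc t)
      fun _ _ => hdis _
  have hsettle : ∀ x₀ x, IsSolution f x₀ x → ∀ t, T ≤ t → x t = p := by
    intro x₀ x hx t ht
    by_contra hne
    have ht0 : 0 ≤ t := hT0.le.trans ht
    -- The distance to `p` never increases, so being off `p` at time `t` keeps `V` positive on all
    -- of `[0, t]`, against the extinction bound.
    have hfar : ∀ s ∈ Icc 0 t, 0 < ‖x s - p‖ := fun s hs =>
      (norm_pos_iff.2 (sub_ne_zero.2 hne)).trans_le (hanti hx hs (right_mem_Icc.2 ht0) hs.2)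
    refine ht.not_gt (lt_of_fixedTime_differential_inequality (V := fun s => ‖x s - p‖ ^ 2 / 2)
      (V' := fun s => inner ℝ (x s - p) (f (x s))) hc₁ hc₂ hκ₁ hκ₂ (fun s hs => ?_)
      (fun s hs => ?_) fun s hs => hf _ ?_)
    · have := ((hx.hasDerivWithinAt_Icc t s hs).sub_const p).norm_sq.div_const 2
      exact this.congr_deriv (by ring)
    · have := hfar s hs
      positivity
    · exact fun h => by simpa [h] using hfar s hs
  have hbound : ∀ x₀, settlingTime f p x₀ ≤ ENNReal.ofReal T := fun x₀ =>
    sInf_le ⟨T, hT0.le, rfl, hsettle x₀⟩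
  refine ⟨⟨⟨⟨hp, hex, fun ε hε => ⟨ε, hε, fun x₀ hx₀ x hx t ht => ?_⟩, fun x₀ x hx => ?_⟩,
    fun x₀ => (hbound x₀).trans_lt ENNReal.ofReal_lt_top⟩, T, hT0, hbound⟩, hbound⟩
  · have := hanti hx (left_mem_Icc.2 ht) (right_mem_Icc.2 ht) ht
    simp only [hx.1] at this
    exact this.trans_lt hx₀
  · exact tendsto_const_nhds.congr' ((eventually_ge_atTop T).mono fun t ht =>
      (hsettle x₀ x hx t ht).symm)

end Stability

/-! ### Lipschitz bounds, smallest singular value and solvability -/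

section Equation

variable {n : ℕ}

theorem norm_cwAbs_sub_cwAbs_le (x y : EuclideanSpace ℝ (Fin n)) :
    ‖cwAbs x - cwAbs y‖ ≤ ‖x - y‖ := by
  rw [EuclideanSpace.norm_eq, EuclideanSpace.norm_eq]
  refine Real.sqrt_le_sqrt (Finset.sum_le_sum fun i _ => ?_)
  have h : ‖(cwAbs x - cwAbs y) i‖ ≤ ‖(x - y) i‖ := by
    simpa [cwAbs] using abs_abs_sub_abs_le (x i) (y i)
  gcongr

/-- The index `1` and the blocks `2^m + 1, …, 2^(m+1)` for `m < k` tile `1, …, 2^k`. Hence each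
matrix in the recursion of `phi` is counted exactly once. -/
theorem sum_dyadic_blocks (a : ℕ → ℝ) (k : ℕ) :
    a 1 + ∑ m ∈ Finset.range k, ∑ j ∈ Finset.Icc 1 (2 ^ m), a (2 ^ m + j) =
      ∑ j ∈ Finset.Icc 1 (2 ^ k), a j := by
  have hI : ∀ (N : ℕ) (f : ℕ → ℝ),
      ∑ j ∈ Finset.Icc 1 N, f j = ∑ j ∈ Finset.range N, f (j + 1) := by
    intro N f
    rw [Finset.range_eq_Ico, Finset.sum_Ico_add' f 0 N 1]
    rfl
  simp only [hI]
  induction k with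
  | zero => simp
  | succ k ih =>
    rw [Finset.sum_range_succ, ← add_assoc, ih, pow_succ, mul_two, Finset.sum_range_add]
    simp only [add_assoc]

theorem norm_mulVecE_sub_le (A : Matrix (Fin n) (Fin n) ℝ) (x y : EuclideanSpace ℝ (Fin n)) :
    ‖mulVecE A x - mulVecE A y‖ ≤ specNorm A * ‖x - y‖ := by
  rw [← map_sub]
  exact (mulVecE A).le_opNorm _

theorem norm_phi_sub_phi_le (k : ℕ) (C : ℕ → Matrix (Fin n) (Fin n) ℝ)
    (c : ℕ → EuclideanSpace ℝ (Fin n)) (x y : EuclideanSpace ℝ (Fin n)) :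
    ‖phi (k + 1) C c x - phi (k + 1) C c y‖ ≤
      (∑ j ∈ Finset.Icc 1 (2 ^ k), specNorm (C j)) * ‖x - y‖ := by
  induction k using Nat.strong_induction_on generalizing C c with
  | _ k ih =>
    rw [phi, phi]
    refine (norm_cwAbs_sub_cwAbs_le _ _).trans ?_
    rw [add_sub_add_comm, add_sub_add_right_eq_sub, ← Finset.sum_sub_distrib,
      ← sum_dyadic_blocks (fun j => specNorm (C j)), add_mul, Finset.sum_mul,
      Finset.sum_range (fun m => (∑ j ∈ Finset.Icc 1 (2 ^ m), specNorm (C (2 ^ m + j))) * ‖x - y‖)]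
    refine (norm_add_le _ _).trans (add_le_add (norm_mulVecE_sub_le _ _ _)
      ((norm_sum_le _ _).trans (Finset.sum_le_sum fun m _ => ?_)))
    exact ih m.1 m.2 _ _

theorem norm_sum_phi_sub_le (s : ℕ) (B : ℕ → ℕ → Matrix (Fin n) (Fin n) ℝ)
    (b : ℕ → ℕ → EuclideanSpace ℝ (Fin n)) (x y : EuclideanSpace ℝ (Fin n)) :
    ‖∑ i ∈ Finset.Icc 1 s, phi i (B i) (b i) x - ∑ i ∈ Finset.Icc 1 s, phi i (B i) (b i) y‖ ≤
      normSum s B * ‖x - y‖ := by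
  rw [← Finset.sum_sub_distrib, normSum, Finset.sum_mul]
  refine (norm_sum_le _ _).trans (Finset.sum_le_sum fun i hi => ?_)
  obtain ⟨k, rfl⟩ := Nat.exists_eq_add_of_le' (Finset.mem_Icc.1 hi).1
  exact norm_phi_sub_phi_le k _ _ x y

theorem normSum_nonneg (s : ℕ) (B : ℕ → ℕ → Matrix (Fin n) (Fin n) ℝ) : 0 ≤ normSum s B :=
  Finset.sum_nonneg fun _ _ => Finset.sum_nonneg fun _ _ => norm_nonneg _

theorem norm_varphi_sub_sub_le (s : ℕ) (B₀ : Matrix (Fin n) (Fin n) ℝ)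
    (B : ℕ → ℕ → Matrix (Fin n) (Fin n) ℝ) (b₀ : EuclideanSpace ℝ (Fin n))
    (b : ℕ → ℕ → EuclideanSpace ℝ (Fin n)) (x y : EuclideanSpace ℝ (Fin n)) :
    ‖varphi s B₀ B b₀ b x - varphi s B₀ B b₀ b y - mulVecE B₀ (x - y)‖ ≤
      normSum s B * ‖x - y‖ := by
  refine le_trans (le_of_eq ?_) (norm_sum_phi_sub_le s B b x y)
  rw [map_sub, varphi, varphi]
  congr 1
  abel

/-- Expand `‖T x‖² = ⟪x, T* T x⟫` in an orthonormal eigenbasis of `T* T`: its eigenvalues are the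
squared singular values, all at least `sigmaMin A ^ 2`. -/
theorem sigmaMin_mul_norm_le (hn : 1 ≤ n) (A : Matrix (Fin n) (Fin n) ℝ)
    (x : EuclideanSpace ℝ (Fin n)) : sigmaMin A * ‖x‖ ≤ ‖mulVecE A x‖ := by
  set T : EuclideanSpace ℝ (Fin n) →ₗ[ℝ] EuclideanSpace ℝ (Fin n) := (mulVecE A).toLinearMap
  have hfr : Module.finrank ℝ (EuclideanSpace ℝ (Fin n)) = n := finrank_euclideanSpace_fin
  have hS := T.isSymmetric_adjoint_comp_self
  have hmin : ∀ i : Fin n, sigmaMin A ^ 2 ≤ hS.eigenvalues hfr i := by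
    intro i
    rw [← T.sq_singularValues_fin hfr i]
    exact pow_le_pow_left₀ (T.singularValues_nonneg _)
      (T.singularValues_antitone (by have := i.2; omega)) 2
  have hsq : (sigmaMin A * ‖x‖) ^ 2 ≤ ‖T x‖ ^ 2 := by
    have h1 : ‖T x‖ ^ 2 = inner ℝ x ((LinearMap.adjoint T ∘ₗ T) x) := by
      rw [LinearMap.comp_apply, LinearMap.adjoint_inner_right, real_inner_self_eq_norm_sq]
    have h2 := (hS.eigenvectorBasis hfr).sum_inner_mul_inner x ((LinearMap.adjoint T ∘ₗ T) x)
    have h3 := (hS.eigenvectorBasis hfr).sum_inner_mul_inner x x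
    rw [h1, ← h2, mul_pow, ← real_inner_self_eq_norm_sq x, ← h3, Finset.mul_sum]
    refine Finset.sum_le_sum fun i _ => ?_
    rw [← hS (hS.eigenvectorBasis hfr i) x, hS.apply_eigenvectorBasis, inner_smul_left,
      real_inner_comm x]
    simp only [RCLike.ofReal_real_eq_id, id, conj_trivial]
    nlinarith [hmin i, mul_self_nonneg (inner ℝ x (hS.eigenvectorBasis hfr i))]
  exact le_of_sq_le_sq hsq (norm_nonneg _)

theorem mulVecE_transpose (A : Matrix (Fin n) (Fin n) ℝ) :
    mulVecE A.transpose = ContinuousLinearMap.adjoint (mulVecE A) := by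
  rw [mulVecE, mulVecE, ← ContinuousLinearMap.star_eq_adjoint, ← map_star,
    Matrix.star_eq_conjTranspose, Matrix.conjTranspose_eq_transpose_of_trivial]

theorem specNorm_transpose (A : Matrix (Fin n) (Fin n) ℝ) :
    specNorm A.transpose = specNorm A := by
  rw [specNorm, mulVecE_transpose, LinearIsometryEquiv.norm_map, specNorm]

theorem inner_mulVecE_transpose (A : Matrix (Fin n) (Fin n) ℝ) (x y : EuclideanSpace ℝ (Fin n)) :
    inner ℝ x (mulVecE A.transpose y) = inner ℝ (mulVecE A x) y := by
  rw [mulVecE_transpose, ContinuousLinearMap.adjoint_inner_right]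

/-- The equation `φ_s(x) = 0` has a solution, by Banach's fixed point theorem. -/
theorem exists_varphi_eq_zero (hn : 1 ≤ n) (s : ℕ) (B₀ : Matrix (Fin n) (Fin n) ℝ)
    (B : ℕ → ℕ → Matrix (Fin n) (Fin n) ℝ) (b₀ : EuclideanSpace ℝ (Fin n))
    (b : ℕ → ℕ → EuclideanSpace ℝ (Fin n)) (hB : normSum s B < sigmaMin B₀) :
    ∃ x, varphi s B₀ B b₀ b x = 0 := by
  have hS := normSum_nonneg s B
  have hσ : 0 < sigmaMin B₀ := hS.trans_lt hB
  have hinj : Function.Injective (mulVecE B₀).toLinearMap := by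
    refine (injective_iff_map_eq_zero _).2 fun x hx => ?_
    have h1 := sigmaMin_mul_norm_le hn B₀ x
    have h2 : ‖mulVecE B₀ x‖ = 0 := by simpa using hx
    rw [h2] at h1
    exact norm_le_zero_iff.1 (nonpos_of_mul_nonpos_right h1 hσ)
  have hsurj : Function.Surjective (mulVecE B₀) := LinearMap.surjective_of_injective hinj
  choose R hR using hsurj
  -- `R` inverts `B₀`, so fixed points of `F` are zeros of `varphi`; the contraction factor is `S /
  -- σ_min(B₀)`.
  set F : EuclideanSpace ℝ (Fin n) → EuclideanSpace ℝ (Fin n) := fun x =>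
    R (-(b₀ + ∑ i ∈ Finset.Icc 1 s, phi i (B i) (b i) x)) with hF
  have hFR : ∀ x, mulVecE B₀ (F x) = -(b₀ + ∑ i ∈ Finset.Icc 1 s, phi i (B i) (b i) x) :=
    fun x => hR _
  have hcontr : ContractingWith (normSum s B / sigmaMin B₀).toNNReal F := by
    refine ⟨?_, LipschitzWith.of_dist_le' fun x y => ?_⟩
    · rw [Real.toNNReal_lt_one]
      exact (div_lt_one hσ).2 hB
    · rw [dist_eq_norm, dist_eq_norm]
      have h1 := sigmaMin_mul_norm_le hn B₀ (F x - F y)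
      have h2 : ‖mulVecE B₀ (F x - F y)‖ ≤ normSum s B * ‖x - y‖ := by
        rw [map_sub, hFR, hFR]
        refine le_trans (le_of_eq ?_) (norm_sum_phi_sub_le s B b x y)
        rw [← norm_neg]
        congr 1
        abel
      rw [div_mul_eq_mul_div, le_div_iff₀ hσ, mul_comm]
      exact h1.trans h2
  obtain ⟨x, hx⟩ : ∃ x, F x = x := ⟨_, hcontr.fixedPoint_isFixedPt⟩
  refine ⟨x, ?_⟩
  have := hFR x
  rw [hx] at this
  rw [varphi, this]
  abel

end Equation

/-! ### Power estimates behind the constants `c₁` and `c₂` -/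

section Powers

theorem sublinear_rate_eq {t ρ γ β D r l : ℝ} (ht : 0 < t) (hγ : 0 < γ) (hβ : 0 < β) (hD : 0 < D)
    (hr : 0 < r) :
    t ^ ((l - 1) / 2) * ρ * γ ^ l / β ^ (1 - l) * D ^ (1 + l) * (r ^ 2 / t) ^ ((l + 1) / 2) =
      ρ / t * γ ^ l / β ^ (1 - l) * (D * r) ^ (1 + l) := by
  have h1 : (r ^ 2 / t) ^ ((l + 1) / 2) = r ^ (1 + l) / t ^ ((l + 1) / 2) := by
    rw [Real.div_rpow (by positivity) ht.le, ← Real.rpow_natCast_mul hr.le]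
    congr 2
    push_cast
    ring
  have h2 : t ^ ((l + 1) / 2) = t ^ ((l - 1) / 2) * t := by
    rw [← Real.rpow_add_one ht.ne']
    congr 1
    ring
  rw [h1, h2, Real.mul_rpow hD.le hr.le]
  have := Real.rpow_pos_of_pos ht ((l - 1) / 2)
  field_simp

/-- Applied with `t = 2`, `D = σ_min(B₀) - S`, `β = ‖B₀‖`, `r = ‖x - p‖`, `P = ‖φ(x)‖`, `G =
‖g(x)‖`, `I = ⟪x - p, g(x)⟫`. Since `1 - l ≥ 0`, an upper bound on `G` is needed, which is how
`‖B₀‖` enters `c₁`. -/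
theorem le_sublinear_rate {t ρ γ β D r l P G I : ℝ} (ht : 0 < t) (hρ : 0 < ρ) (hγ : 0 < γ)
    (hβ : 0 < β) (hD : 0 < D) (hr : 0 < r) (hl : -1 ≤ l) (hl1 : l ≤ 1) (hP : D * r ≤ P)
    (hG0 : 0 < G) (hG : G ≤ γ * β * P) (hI : γ * P ^ 2 / t ≤ I) :
    t ^ ((l - 1) / 2) * ρ * γ ^ l / β ^ (1 - l) * D ^ (1 + l) * (r ^ 2 / t) ^ ((l + 1) / 2) ≤
      ρ / G ^ (1 - l) * I := by
  have hP0 : 0 < P := (mul_pos hD hr).trans_le hP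
  rw [sublinear_rate_eq ht hγ hβ hD hr]
  calc ρ / t * γ ^ l / β ^ (1 - l) * (D * r) ^ (1 + l)
      ≤ ρ / t * γ ^ l / β ^ (1 - l) * P ^ (1 + l) := by
        gcongr
        linarith
    _ = ρ / (γ * β * P) ^ (1 - l) * (γ * P ^ 2 / t) := by
        rw [Real.mul_rpow (by positivity) hP0.le, Real.mul_rpow hγ.le hβ.le]
        have e1 : γ = γ ^ l * γ ^ (1 - l) := by
          rw [← Real.rpow_add hγ]; simp
        have e2 : P ^ 2 = P ^ (1 + l) * P ^ (1 - l) := by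
          rw [← Real.rpow_add hP0, ← Real.rpow_natCast]
          congr 1
          push_cast
          ring
        have := Real.rpow_pos_of_pos hγ (1 - l)
        have := Real.rpow_pos_of_pos hβ (1 - l)
        have := Real.rpow_pos_of_pos hP0 (1 - l)
        rw [e2]
        nth_rewrite 3 [e1]
        field_simp
    _ ≤ ρ / G ^ (1 - l) * I := by
        have : 0 ≤ 1 - l := by linarith
        gcongr

theorem superlinear_rate_eq {t ρ γ D r l : ℝ} (ht : 0 < t) (hγ : 0 < γ) (hD : 0 < D)
    (hr : 0 < r) :
    t ^ ((1 - l) / 2) * ρ * γ ^ l * D ^ (2 * l) * (r ^ 2 / t) ^ ((l + 1) / 2) =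
      ρ * (γ * (D * r) ^ 2 / t / r) ^ (l - 1) * (γ * (D * r) ^ 2 / t) := by
  have h1 : (r ^ 2 / t) ^ ((l + 1) / 2) = r ^ (l - 1) * r ^ 2 / (t ^ ((1 - l) / 2) * t ^ l) := by
    rw [Real.div_rpow (by positivity) ht.le, ← Real.rpow_natCast_mul hr.le, ← Real.rpow_add ht,
      ← Real.rpow_add_natCast hr.ne']
    congr 2 <;> push_cast <;> ring
  have h2 : γ * (D * r) ^ 2 / t / r = γ * D ^ 2 * r / t := by field_simp
  have h3 : (γ * D ^ 2 * r / t) ^ (l - 1) =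
      γ ^ l / γ * (D ^ (2 * l) / D ^ 2) * r ^ (l - 1) / (t ^ l / t) := by
    rw [Real.div_rpow (by positivity) ht.le, Real.mul_rpow (by positivity) hr.le,
      Real.mul_rpow hγ.le (by positivity), ← Real.rpow_natCast_mul hD.le,
      Real.rpow_sub_one hγ.ne', Real.rpow_sub_one ht.ne', ← Real.rpow_sub_natCast hD.ne']
    congr 4
    push_cast
    ring
  rw [h1, h2, h3]
  have := Real.rpow_pos_of_pos ht ((1 - l) / 2)
  have := Real.rpow_pos_of_pos ht l
  field_simp

/-- Now `1 - l ≤ 0`, so a lower bound on `G` is needed. Cauchy–Schwarz supplies `G ≥ I / r`, and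
`‖B₀‖` does not appear in `c₂`. -/
theorem le_superlinear_rate {t ρ γ D r l P G I : ℝ} (ht : 0 < t) (hρ : 0 < ρ) (hγ : 0 < γ)
    (hD : 0 < D) (hr : 0 < r) (hl : 1 ≤ l) (hP : D * r ≤ P) (hG : I ≤ G * r)
    (hI : γ * P ^ 2 / t ≤ I) :
    t ^ ((1 - l) / 2) * ρ * γ ^ l * D ^ (2 * l) * (r ^ 2 / t) ^ ((l + 1) / 2) ≤
      ρ / G ^ (1 - l) * I := by
  have hI' : γ * (D * r) ^ 2 / t ≤ I := by
    refine le_trans ?_ hI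
    gcongr
  have hI0 : 0 < I := (by positivity : 0 < γ * (D * r) ^ 2 / t).trans_le hI'
  have hG' : I / r ≤ G := (div_le_iff₀ hr).2 hG
  have hG0 : 0 < G := (div_pos hI0 hr).trans_le hG'
  rw [superlinear_rate_eq ht hγ hD hr, show ρ / G ^ (1 - l) = ρ * G ^ (l - 1) by
    rw [div_eq_mul_inv, ← Real.rpow_neg hG0.le, neg_sub]]
  have : 0 ≤ l - 1 := by linarith
  gcongr
  exact le_trans (by gcongr) hG'

end Powers

/-! ### Regularity of the scalar factor -/

section Factor

variable {ρ₁ ρ₂ l₁ l₂ : ℝ}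

theorem locallyLipschitz_comp_max {h : ℝ → ℝ} (hh : ∀ u, 0 < u → ContDiffAt ℝ 1 h u) {ε : ℝ}
    (hε : 0 < ε) : LocallyLipschitz fun u => h (max ε u) := by
  intro u
  have hm : LipschitzWith 1 fun u : ℝ => max ε u := LipschitzWith.id.const_max ε
  obtain ⟨K, s, hs, hK⟩ := (hh (max ε u) (lt_max_of_lt_left hε)).exists_lipschitzOnWith
  exact ⟨K * 1, _, hm.continuous.continuousAt hs,
    hK.comp (hm.lipschitzOnWith (s := _)) (mapsTo_preimage _ s)⟩

theorem contDiffAt_factor {u : ℝ} (hu : 0 < u) :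
    ContDiffAt ℝ 1 (fun u : ℝ => ρ₁ / u ^ (1 - l₁) + ρ₂ / u ^ (1 - l₂)) u := by
  have h : ∀ ρ l : ℝ, ContDiffAt ℝ 1 (fun u : ℝ => ρ / u ^ (1 - l)) u := fun ρ l =>
    contDiffAt_const.div (Real.contDiffAt_rpow_const_of_ne hu.ne') (Real.rpow_pos_of_pos hu _).ne'
  exact (h ρ₁ l₁).add (h ρ₂ l₂)

/-- Each term times `u` is `ρ * u ^ l` with `l > 0`: the factor may blow up at `0`, but the field
stays continuous. -/
theorem tendsto_factor_mul_self (hl₁ : 0 < l₁) (hl₂ : 0 < l₂) :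
    Tendsto (fun u : ℝ => (ρ₁ / u ^ (1 - l₁) + ρ₂ / u ^ (1 - l₂)) * u) (𝓝[>] 0) (𝓝 0) := by
  have h : ∀ ρ l : ℝ, 0 < l → Tendsto (fun u : ℝ => ρ * u ^ l) (𝓝[>] 0) (𝓝 0) := by
    intro ρ l hl
    have := ((Real.continuousAt_rpow_const 0 l (Or.inr hl.le)).tendsto.const_mul ρ)
    rw [Real.zero_rpow hl.ne', mul_zero] at this
    exact this.mono_left nhdsWithin_le_nhds
  have h2 := (h ρ₁ l₁ hl₁).add (h ρ₂ l₂ hl₂)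
  rw [add_zero] at h2
  refine h2.congr' ?_
  filter_upwards [self_mem_nhdsWithin] with u hu
  have hu : 0 < u := hu
  have e : ∀ ρ l : ℝ, ρ / u ^ (1 - l) * u = ρ * u ^ l := by
    intro ρ l
    rw [Real.rpow_sub hu, Real.rpow_one]
    field_simp
  rw [add_mul, e, e]

end Factor

/-! ### The model field and its angle with `x - p` -/

section Model

variable {n : ℕ}

theorem gField_eq_zero_iff {B₀ : Matrix (Fin n) (Fin n) ℝ}
    {φ : EuclideanSpace ℝ (Fin n) → EuclideanSpace ℝ (Fin n)} {γ : ℝ} (hγ : γ ≠ 0)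
    {x : EuclideanSpace ℝ (Fin n)} : gField B₀ φ γ x = 0 ↔ x ∈ solSet B₀ φ := by
  simp [gField, solSet, hγ]

/-- On `solSet` the two scalar factors may differ, but `g` vanishes there. -/
theorem modelField_eq_regField (B₀ : Matrix (Fin n) (Fin n) ℝ)
    (φ : EuclideanSpace ℝ (Fin n) → EuclideanSpace ℝ (Fin n)) {γ : ℝ} (hγ : γ ≠ 0)
    (ρ₁ ρ₂ l₁ l₂ : ℝ) :
    modelField B₀ φ γ ρ₁ ρ₂ l₁ l₂ =
      regField (fun u => ρ₁ / u ^ (1 - l₁) + ρ₂ / u ^ (1 - l₂)) (gField B₀ φ γ) 0 := by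
  funext x
  by_cases hx : x ∈ solSet B₀ φ
  · simp [modelField, regField, (gField_eq_zero_iff hγ).2 hx]
  · simp [modelField, regField, rho, hx]

theorem locallyLipschitz_gField (s : ℕ) (B₀ : Matrix (Fin n) (Fin n) ℝ)
    (B : ℕ → ℕ → Matrix (Fin n) (Fin n) ℝ) (b₀ : EuclideanSpace ℝ (Fin n))
    (b : ℕ → ℕ → EuclideanSpace ℝ (Fin n)) (γ : ℝ) :
    LocallyLipschitz (gField B₀ (varphi s B₀ B b₀ b) γ) := by
  have hφ : LipschitzWith (Real.toNNReal (normSum s B + specNorm B₀)) (varphi s B₀ B b₀ b) := by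
    refine LipschitzWith.of_dist_le' fun x y => ?_
    rw [dist_eq_norm, dist_eq_norm, add_mul]
    have h1 := norm_varphi_sub_sub_le s B₀ B b₀ b x y
    have h2 : ‖mulVecE B₀ (x - y)‖ ≤ specNorm B₀ * ‖x - y‖ := (mulVecE B₀).le_opNorm _
    have h3 := norm_sub_norm_le (varphi s B₀ B b₀ b x - varphi s B₀ B b₀ b y) (mulVecE B₀ (x - y))
    linarith
  exact ((γ • mulVecE B₀.transpose).lipschitz.comp hφ).locallyLipschitz

variable {s : ℕ} {B₀ : Matrix (Fin n) (Fin n) ℝ} {B : ℕ → ℕ → Matrix (Fin n) (Fin n) ℝ}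
  {b₀ : EuclideanSpace ℝ (Fin n)} {b : ℕ → ℕ → EuclideanSpace ℝ (Fin n)} {γ : ℝ}
  {p : EuclideanSpace ℝ (Fin n)}

theorem sub_mul_norm_le_norm_varphi (hn : 1 ≤ n) (hp : varphi s B₀ B b₀ b p = 0)
    (x : EuclideanSpace ℝ (Fin n)) :
    (sigmaMin B₀ - normSum s B) * ‖x - p‖ ≤ ‖varphi s B₀ B b₀ b x‖ := by
  have h1 := norm_varphi_sub_sub_le s B₀ B b₀ b x p
  rw [hp, sub_zero] at h1
  have h2 := sigmaMin_mul_norm_le hn B₀ (x - p)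
  have h3 := norm_sub_norm_le (mulVecE B₀ (x - p)) (varphi s B₀ B b₀ b x)
  rw [norm_sub_rev] at h3
  linarith

/-- Expanding the square in `‖φ(x) - B₀(x - p)‖ ≤ ‖B₀(x - p)‖` cancels `‖B₀(x - p)‖²` and leaves
`‖φ(x)‖² ≤ 2⟪B₀(x - p), φ(x)⟫`. -/
theorem sq_norm_varphi_le_inner_gField (hn : 1 ≤ n) (hB : normSum s B ≤ sigmaMin B₀)
    (hγ : 0 ≤ γ) (hp : varphi s B₀ B b₀ b p = 0) (x : EuclideanSpace ℝ (Fin n)) :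
    γ * ‖varphi s B₀ B b₀ b x‖ ^ 2 / 2 ≤
      inner ℝ (x - p) (gField B₀ (varphi s B₀ B b₀ b) γ x) := by
  rw [gField, inner_smul_right, inner_mulVecE_transpose, mul_div_assoc]
  refine mul_le_mul_of_nonneg_left ?_ hγ
  have h1 := norm_varphi_sub_sub_le s B₀ B b₀ b x p
  rw [hp, sub_zero] at h1
  have h2 : ‖varphi s B₀ B b₀ b x - mulVecE B₀ (x - p)‖ ≤ ‖mulVecE B₀ (x - p)‖ :=
    (h1.trans (mul_le_mul_of_nonneg_right hB (norm_nonneg _))).trans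
      (sigmaMin_mul_norm_le hn B₀ (x - p))
  have h3 := pow_le_pow_left₀ (norm_nonneg _) h2 2
  rw [norm_sub_sq_real, real_inner_comm] at h3
  linarith

theorem norm_gField_le (hγ : 0 ≤ γ) (φ : EuclideanSpace ℝ (Fin n) → EuclideanSpace ℝ (Fin n))
    (x : EuclideanSpace ℝ (Fin n)) :
    ‖gField B₀ φ γ x‖ ≤ γ * specNorm B₀ * ‖φ x‖ := by
  rw [gField, norm_smul, Real.norm_of_nonneg hγ, mul_assoc, ← specNorm_transpose]
  exact mul_le_mul_of_nonneg_left ((mulVecE _).le_opNorm _) hγ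

end Model

end NGAVE

theorem mainTheorem1 (n s : ℕ) (hn : 1 ≤ n) (hs : 1 ≤ s)
    (B₀ : Matrix (Fin n) (Fin n) ℝ) (B : ℕ → ℕ → Matrix (Fin n) (Fin n) ℝ)
    (b₀ : EuclideanSpace ℝ (Fin n)) (b : ℕ → ℕ → EuclideanSpace ℝ (Fin n))
    (γ ρ₁ ρ₂ l₁ l₂ : ℝ) (hγ : 0 < γ) (hρ₁ : 0 < ρ₁) (hρ₂ : 0 < ρ₂)
    (hl₁ : l₁ ∈ Set.Ioo (0 : ℝ) 1) (hl₂ : 1 < l₂)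
    (hB : NGAVE.normSum s B < NGAVE.sigmaMin B₀)
    (f : EuclideanSpace ℝ (Fin n) → EuclideanSpace ℝ (Fin n))
    (hf : f = NGAVE.modelField B₀ (NGAVE.varphi s B₀ B b₀ b) γ ρ₁ ρ₂ l₁ l₂)
    (c₁ c₂ κ₁ κ₂ : ℝ)
    (hc₁ : c₁ = (2 : ℝ) ^ ((l₁ - 1) / 2) * ρ₁ * γ ^ l₁ / NGAVE.specNorm B₀ ^ (1 - l₁) *
      (NGAVE.sigmaMin B₀ - NGAVE.normSum s B) ^ (1 + l₁))
    (hc₂ : c₂ = (2 : ℝ) ^ ((1 - l₂) / 2) * ρ₂ * γ ^ l₂ *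
      (NGAVE.sigmaMin B₀ - NGAVE.normSum s B) ^ (2 * l₂))
    (hκ₁ : κ₁ = (l₁ + 1) / 2) (hκ₂ : κ₂ = (l₂ + 1) / 2) :
    (∃! xs, NGAVE.IsEquilibrium f xs) ∧
    (∀ x₀, ∃ x : ℝ → EuclideanSpace ℝ (Fin n), NGAVE.IsSolution f x₀ x ∧
      ∀ y : ℝ → EuclideanSpace ℝ (Fin n), NGAVE.IsSolution f x₀ y → Set.EqOn y x (Set.Ici 0)) ∧
    ∀ xs, NGAVE.IsEquilibrium f xs →
      NGAVE.IsGloballyFixedTimeStable f xs ∧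
      ∀ x₀, NGAVE.settlingTime f xs x₀ ≤
        ENNReal.ofReal (1 / (c₁ * (1 - κ₁)) + 1 / (c₂ * (κ₂ - 1))) := by
  obtain ⟨hl0, hl1⟩ := hl₁
  obtain ⟨p, hp⟩ := NGAVE.exists_varphi_eq_zero hn s B₀ B b₀ b hB
  set D := NGAVE.sigmaMin B₀ - NGAVE.normSum s B with hDdef
  have hD : 0 < D := sub_pos.2 hB
  -- Testing on a unit coordinate vector, available since `n ≥ 1`, gives `σ_min(B₀) ≤ ‖B₀‖`.
  have hβ : 0 < NGAVE.specNorm B₀ := by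
    have hσ : 0 < NGAVE.sigmaMin B₀ := (NGAVE.normSum_nonneg s B).trans_lt hB
    have h1 := NGAVE.sigmaMin_mul_norm_le hn B₀ (EuclideanSpace.single ⟨0, hn⟩ 1)
    have h2 := h1.trans ((NGAVE.mulVecE B₀).le_opNorm _)
    simp only [PiLp.norm_single, norm_one, mul_one] at h2
    exact hσ.trans_le h2
  set φ := NGAVE.varphi s B₀ B b₀ b with hφ
  set g := NGAVE.gField B₀ φ γ with hg
  set h : ℝ → ℝ := fun u => ρ₁ / u ^ (1 - l₁) + ρ₂ / u ^ (1 - l₂) with hh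
  have hfr : f = NGAVE.regField h g 0 :=
    hf.trans (NGAVE.modelField_eq_regField B₀ φ hγ.ne' ρ₁ ρ₂ l₁ l₂)
  have hfx : ∀ x, f x = -(h ‖g x‖ • g x) := fun x => by
    rw [hfr, NGAVE.regField, max_eq_right (norm_nonneg _)]
  have hPx : ∀ x, D * ‖x - p‖ ≤ ‖φ x‖ := NGAVE.sub_mul_norm_le_norm_varphi hn hp
  have hIx : ∀ x, γ * ‖φ x‖ ^ 2 / 2 ≤ inner ℝ (x - p) (g x) :=
    NGAVE.sq_norm_varphi_le_inner_gField hn hB.le hγ.le hp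
  have hm0 : 0 < γ * D ^ 2 / 2 := by positivity
  have hm : ∀ x, γ * D ^ 2 / 2 * ‖x - p‖ ^ 2 ≤ inner ℝ (x - p) (g x) := by
    intro x
    have h1 := pow_le_pow_left₀ (by positivity) (hPx x) 2
    have h2 := mul_le_mul_of_nonneg_left h1 hγ.le
    have := hIx x
    linarith
  have hpos : ∀ u, 0 < u → 0 < h u := fun u hu => by positivity
  have hex := NGAVE.existsUnique_isSolution_regField_zero
    (NGAVE.locallyLipschitz_gField s B₀ B b₀ b γ) hm0 hm (fun u hu => (hpos u hu).le)
    (fun u hu => (NGAVE.contDiffAt_factor hu).continuousAt.continuousWithinAt)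
    (fun ε hε => NGAVE.locallyLipschitz_comp_max (fun u hu => NGAVE.contDiffAt_factor hu) hε)
    (NGAVE.tendsto_factor_mul_self hl0 (zero_lt_one.trans hl₂))
  rw [← hfr] at hex
  have hgp : g p = 0 := by simp [hg, NGAVE.gField, hp]
  have hgne : ∀ x, x ≠ p → 0 < ‖g x‖ := fun x hx =>
    (mul_pos hm0 (norm_pos_iff.2 (sub_ne_zero.2 hx))).trans_le
      (NGAVE.mul_norm_sub_le_of_inner hm x)
  have hpe : NGAVE.IsEquilibrium f p := by
    simp [NGAVE.IsEquilibrium, hfx, hgp]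
  have huniq : ∀ x, NGAVE.IsEquilibrium f x → x = p := by
    intro x hx
    by_contra hne
    have hx0 : h ‖g x‖ • g x = 0 := neg_eq_zero.1 ((hfx x).symm.trans hx)
    rcases smul_eq_zero.1 hx0 with h0 | h0
    · exact (hpos _ (hgne x hne)).ne' h0
    · exact (hgne x hne).ne' (by rw [h0, norm_zero])
  refine ⟨⟨p, hpe, huniq⟩, hex, fun xs hxs => ?_⟩
  obtain rfl := huniq xs hxs
  refine NGAVE.isGloballyFixedTimeStable_of_inner_le (by rw [hc₁]; positivity)
    (by rw [hc₂]; positivity) (by rw [hκ₁]; linarith) (by rw [hκ₂]; linarith) hpe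
    (fun x₀ => (hex x₀).imp fun _ hx => hx.1) fun x hx => ?_
  have hr : 0 < ‖x - xs‖ := norm_pos_iff.2 (sub_ne_zero.2 hx)
  rw [hfx, inner_neg_right, inner_smul_right, neg_le_neg_iff, hh, add_mul, hc₁, hc₂, hκ₁, hκ₂]
  -- The two summands of `ρ(x)` yield the two powers of `V` separately.
  refine add_le_add ?_ ?_
  · exact NGAVE.le_sublinear_rate two_pos hρ₁ hγ hβ hD hr (by linarith) hl1.le (hPx x) (hgne x hx)
      (NGAVE.norm_gField_le hγ.le φ x) (hIx x)
  · exact NGAVE.le_superlinear_rate two_pos hρ₂ hγ hD hr hl₂.le (hPx x)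
      ((real_inner_le_norm _ _).trans_eq (mul_comm _ _)) (hIx x)
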